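/- Let $(X,\mathcal B)$ be a standard Borel space and let $\mathcal F(X)$ be the real vector space of all real-valued Borel functions on $X$. Let $\sigma:X\to X$ be a surjective Borel map and let $R:\mathcal F(X)\to\mathcal F(X)$ be a normalized transfer operator over $\sigma$: $R$ is linear, $f\ge 0$ implies $R(f)\ge 0$, $R((f\circ\sigma)g)=f\,R(g)$ for all $f,g\in\mathcal F(X)$, and $R(\mathbf 1)=\mathbf 1$. For a Borel measure $\mu$ let $\mu R$ be the measure $(\mu R)(A)=\int_X R(\chi_A)\,d\mu$, and let $K_1=\{\nu R:\nu \text{ a Borel probability measure on } X\}$. Let $\mathcal H(X)$ be the universal Hilbert space, that is, the set of classes $f\sqrt{d\mu}$ of pairs $(f,\mu)$, where $\mu$ is a $\sigma$-finite Borel measure and $f\in L^2(\mu)$ is real-valued, and where $(f,\mu)\sim(g,\nu)$ if $f\sqrt{d\mu/d\lambda}=g\sqrt{d\nu/d\lambda}$ holds $\lambda$-a.e. for some $\sigma$-finite $\lambda$ with $\mu,\nu\ll\lambda$; its operations and inner product are (for any such $\lambda$) $$f\sqrt{d\mu}+g\sqrt{d\nu}=\Big(f\sqrt{\tfrac{d\mu}{d\lambda}}+g\sqrt{\tfrac{d\nu}{d\lambda}}\Big)\sqrt{d\lambda},\qquad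 c\,(f\sqrt{d\mu})=(cf)\sqrt{d\mu},\qquad \langle f\sqrt{d\mu},g\sqrt{d\nu}\rangle=\int_X fg\sqrt{\tfrac{d\mu}{d\lambda}}\sqrt{\tfrac{d\nu}{d\lambda}}\,d\lambda .$$ Let $\mathcal H_{K_1}$ be the closed linear span of all $f\sqrt{d\lambda}$ with $\lambda\in K_1$, $f\in L^2(\lambda)$. Then: 1. there is exactly one map $\widehat S:\mathcal H(X)\to\mathcal H(X)$ with $\widehat S(f\sqrt{d\lambda})=(f\circ\sigma)\sqrt{d(\lambda R)}$ for all Borel probability measures $\lambda$ and all Borel $f\in L^2(\lambda)$, and it is linear and bounded; 2. there is exactly one linear map $\widehat R:\mathcal H(X)\to\mathcal H(X)$ with $\widehat R(f\sqrt{d\lambda})=R(f)\sqrt{d(\lambda\circ\sigma^{-1})}$ for all $\lambda\in K_1$ and all Borel $f\in L^2(\lambda)$, and with $\widehat R=0$ on $\mathcal H_{K_1}^{\perp}$, and it is bounded; 3. $\widehat R=\widehat S^{*}$, so $(\widehat S,\widehat R)$ is a symmetric pair: $\langle\widehat S u,v\rangle=\langle u,\widehat R v\rangle$ for all $u,v\in\mathcal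 H(X)$. -/

import Mathlib

open MeasureTheory Filter
open scoped ENNReal

namespace UHS

noncomputable section

/-! ### Borel functions and transfer operators -/

/-- The real vector space `F(X)` of all real-valued Borel functions on `X`. -/
def BorelFun (X : Type*) [MeasurableSpace X] : Submodule ℝ (X → ℝ) where
  carrier := {f | Measurable f}
  add_mem' hf hg := hf.add hg
  zero_mem' := measurable_const
  smul_mem' c _ hf := hf.const_smul c

/-- The indicator function of a Borel set. -/
def indic {X : Type*} [MeasurableSpace X] (A : Set X) (hA : MeasurableSet A) : BorelFun X :=
  ⟨A.indicator fun _ => 1, measurable_const.indicator hA⟩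

/-- The constant function `1`. -/
def oneFun (X : Type*) [MeasurableSpace X] : BorelFun X := ⟨fun _ => 1, measurable_const⟩

/-- A transfer operator `(R, σ)`: a surjective Borel endomorphism `σ` of `X` and a positive linear
operator `R` on the space of Borel functions with the pull-out property
`R ((f ∘ σ) g) = f R(g)`. -/
structure TransferOperator (X : Type*) [MeasurableSpace X] where
  σ : X → X
  measurable_σ : Measurable σ
  surjective_σ : Function.Surjective σ
  R : BorelFun X →ₗ[ℝ] BorelFun X
  nonneg : ∀ f : BorelFun X, (∀ x, 0 ≤ f.1 x) → ∀ x, 0 ≤ (R f).1 x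
  pull_out : ∀ f g : BorelFun X,
    R ⟨fun x => f.1 (σ x) * g.1 x, (f.2.comp measurable_σ).mul g.2⟩ =
      ⟨fun x => f.1 x * (R g).1 x, f.2.mul (R g).2⟩

namespace TransferOperator

variable {X : Type*} [MeasurableSpace X]

/-- `R` is normalized: `R(1) = 1`. -/
def Normalized (T : TransferOperator X) : Prop := T.R (oneFun X) = oneFun X

theorem mono (T : TransferOperator X) {f g : BorelFun X} (h : ∀ x, f.1 x ≤ g.1 x) (x : X) :
    (T.R f).1 x ≤ (T.R g).1 x := by
  have := T.nonneg (g - f) (fun y => by simpa using h y) x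
  rw [map_sub] at this
  simpa using this

theorem R_empty (T : TransferOperator X) : T.R (indic ∅ MeasurableSet.empty) = 0 := by
  have : (indic ∅ MeasurableSet.empty : BorelFun X) = 0 := by
    ext x; simp [indic]
  rw [this, map_zero]

/-- A positive operator on the space of all Borel functions is countably additive on
indicators. -/
theorem hasSum_indic (T : TransferOperator X) (A : ℕ → Set X) (hA : ∀ i, MeasurableSet (A i))
    (hd : Pairwise (Function.onFun Disjoint A)) (x : X) :
    HasSum (fun i => (T.R (indic (A i) (hA i))).1 x)
      ((T.R (indic (⋃ i, A i) (MeasurableSet.iUnion hA))).1 x) := by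
  classical
  -- the tail indicators are bounded by `F / N` with `F = ∑ i • 1_{A i}`
  let F : BorelFun X := ⟨fun y => ∑' i, (A i).indicator (fun _ => (i : ℝ)) y, by
    exact Measurable.tsum (fun i => measurable_const.indicator (hA i))⟩
  have hF : ∀ i y, y ∈ A i → F.1 y = i := by
    intro i y hy
    change ∑' j, (A j).indicator (fun _ => (j : ℝ)) y = i
    rw [tsum_eq_single i]
    · simp [hy]
    · intro j hj
      have : y ∉ A j := fun h => Set.disjoint_left.1 (hd hj) h hy
      simp [this]
  have hF0 : ∀ y, 0 ≤ F.1 y := fun y =>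
    tsum_nonneg fun i => Set.indicator_nonneg (fun _ _ => by positivity) _
  let U : BorelFun X := indic (⋃ i, A i) (MeasurableSet.iUnion hA)
  have hsum_le : ∀ s : ℕ → BorelFun X, ∀ N, ∀ y,
      (∑ i ∈ Finset.range N, s i : BorelFun X).1 y = ∑ i ∈ Finset.range N, (s i).1 y := by
    intro s N y
    simp
  have hpt : ∀ N y, (∑ i ∈ Finset.range N, (indic (A i) (hA i)).1 y) =
      if ∃ i < N, y ∈ A i then 1 else 0 := by
    intro N y
    split_ifs with h
    · obtain ⟨i, hi, hy⟩ := h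
      rw [Finset.sum_eq_single i]
      · simp [indic, hy]
      · intro j _ hj
        have : y ∉ A j := fun h => Set.disjoint_left.1 (hd hj) h hy
        simp [indic, this]
      · intro h; simp at h; omega
    · apply Finset.sum_eq_zero
      intro i hi
      have : y ∉ A i := fun hy => h ⟨i, Finset.mem_range.1 hi, hy⟩
      simp [indic, this]
  have hle : ∀ N y, (∑ i ∈ Finset.range N, (indic (A i) (hA i)).1 y) ≤ U.1 y := by
    intro N y
    rw [hpt]
    split_ifs with h
    · obtain ⟨i, _, hy⟩ := h
      have : y ∈ ⋃ i, A i := Set.mem_iUnion.2 ⟨i, hy⟩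
      simp [U, indic, this]
    · exact Set.indicator_nonneg (fun _ _ => zero_le_one) _
  have htail : ∀ (N : ℕ) (y : X), (N : ℝ) * (U.1 y - ∑ i ∈ Finset.range N, (indic (A i) (hA i)).1 y)
      ≤ F.1 y := by
    intro N y
    by_cases hy : y ∈ ⋃ i, A i
    · obtain ⟨i, hi⟩ := Set.mem_iUnion.1 hy
      have hU : U.1 y = 1 := by simp [U, indic, -Set.mem_iUnion, hy]
      rw [hpt, hU]
      split_ifs with h
      · simpa using hF0 y
      · rw [hF i y hi]
        have : N ≤ i := by
          by_contra hlt
          exact h ⟨i, by omega, hi⟩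
        simpa using this
    · have hU : U.1 y = 0 := by simp [U, indic, -Set.mem_iUnion, hy]
      have : ¬ ∃ i < N, y ∈ A i := fun ⟨i, _, h⟩ => hy (Set.mem_iUnion.2 ⟨i, h⟩)
      rw [hpt, hU, if_neg this]
      simpa using hF0 y
  rw [hasSum_iff_tendsto_nat_of_nonneg
    (fun i => T.nonneg _ (fun y => Set.indicator_nonneg (fun _ _ => zero_le_one) _) x)]
  have hR : ∀ N, (∑ i ∈ Finset.range N, (T.R (indic (A i) (hA i))).1 x)
      = (T.R (∑ i ∈ Finset.range N, indic (A i) (hA i))).1 x := by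
    intro N
    rw [map_sum, hsum_le]
  have h1 : ∀ N, (∑ i ∈ Finset.range N, (T.R (indic (A i) (hA i))).1 x) ≤ (T.R U).1 x := by
    intro N
    rw [hR]
    exact T.mono (fun y => by rw [hsum_le]; exact hle N y) x
  have h2 : ∀ N : ℕ, (N : ℝ) * ((T.R U).1 x -
      ∑ i ∈ Finset.range N, (T.R (indic (A i) (hA i))).1 x) ≤ (T.R F).1 x := by
    intro N
    have := T.mono (f := (N : ℝ) • (U - ∑ i ∈ Finset.range N, indic (A i) (hA i))) (g := F)
      (fun y => by
        have := htail N y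
        rw [← hsum_le] at this
        exact this) x
    rw [map_smul, map_sub] at this
    rw [hR]
    exact this
  have h3 : Tendsto (fun N : ℕ => (T.R U).1 x - (T.R F).1 x / N) atTop
      (nhds ((T.R U).1 x)) := by
    simpa using tendsto_const_nhds.sub (tendsto_const_div_atTop_nhds_zero_nat ((T.R F).1 x))
  refine tendsto_of_tendsto_of_tendsto_of_le_of_le' h3 tendsto_const_nhds ?_
    (Eventually.of_forall h1)
  filter_upwards [eventually_gt_atTop 0] with N hN
  have hN' : (0 : ℝ) < N := by exact_mod_cast hN
  have := h2 N
  rw [sub_le_comm, le_div_iff₀ hN']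
  linarith

/-- The action `λ ↦ λR` of a transfer operator on measures: `(λR)(A) = ∫ R(1_A) dλ`. -/
def act (T : TransferOperator X) (μ : Measure X) : Measure X :=
  Measure.ofMeasurable (fun A hA => ∫⁻ x, ENNReal.ofReal ((T.R (indic A hA)).1 x) ∂μ)
    (by rw [T.R_empty]; simp)
    (by
      intro A hA hd
      rw [← lintegral_tsum fun i => (T.R (indic (A i) (hA i))).2.ennreal_ofReal.aemeasurable]
      refine lintegral_congr fun x => ?_
      have h := T.hasSum_indic A hA hd x
      rw [← h.tsum_eq, ENNReal.ofReal_tsum_of_nonneg _ h.summable]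
      exact fun i => T.nonneg _ (fun y => Set.indicator_nonneg (fun _ _ => zero_le_one) _) x)

theorem act_apply (T : TransferOperator X) (μ : Measure X) {A : Set X} (hA : MeasurableSet A) :
    T.act μ A = ∫⁻ x, ENNReal.ofReal ((T.R (indic A hA)).1 x) ∂μ :=
  Measure.ofMeasurable_apply A hA

/-- The set `K₁ = M₁(X) R` of measures `νR`, with `ν` a Borel probability measure. -/
def K₁ (T : TransferOperator X) : Set (Measure X) :=
  {μ | ∃ ν : Measure X, IsProbabilityMeasure ν ∧ T.act ν = μ}

end TransferOperator

/-! ### The universal Hilbert space -/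

/-- A pair `(f, μ)` with `μ` a σ-finite Borel measure on `X` and `f ∈ L²(μ)` real-valued. -/
structure Pair (X : Type*) [MeasurableSpace X] where
  f : X → ℝ
  μ : Measure X
  sigmaFinite : SigmaFinite μ
  measurable : Measurable f
  memLp : MemLp f 2 μ

attribute [instance] Pair.sigmaFinite

namespace Pair

variable {X : Type*} [MeasurableSpace X]

/-- The function `f √(dμ/dlam)`. -/
def dens (p : Pair X) (lam : Measure X) (x : X) : ℝ :=
  p.f x * √((p.μ.rnDeriv lam x).toReal)

/-- Equivalence of pairs: `f √(dμ/dlam) = g √(dν/dlam)` holds `lam`-a.e. for some σ-finite `lam`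
with `μ ≪ lam` and `ν ≪ lam`. -/
def Rel (p q : Pair X) : Prop :=
  ∃ lam : Measure X, SigmaFinite lam ∧ p.μ ≪ lam ∧ q.μ ≪ lam ∧ p.dens lam =ᵐ[lam] q.dens lam

theorem measurable_dens (p : Pair X) (lam : Measure X) : Measurable (p.dens lam) :=
  p.measurable.mul (Measure.measurable_rnDeriv _ _).ennreal_toReal.sqrt

theorem dens_chain (p : Pair X) {lam lam' : Measure X} [SigmaFinite lam] [SigmaFinite lam']
    (h : p.μ ≪ lam) :
    p.dens lam' =ᵐ[lam'] fun x => p.dens lam x * √((lam.rnDeriv lam' x).toReal) := by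
  filter_upwards [Measure.rnDeriv_mul_rnDeriv (κ := lam') h] with x hx
  simp only [dens]
  rw [← hx, Pi.mul_apply, ENNReal.toReal_mul, Real.sqrt_mul ENNReal.toReal_nonneg, mul_assoc]

theorem ae_eq_iff_mul_sqrt {lam lam' : Measure X} [SigmaFinite lam] [SigmaFinite lam']
    (h : lam ≪ lam') (f g : X → ℝ) :
    f =ᵐ[lam] g ↔ (fun x => f x * √((lam.rnDeriv lam' x).toReal)) =ᵐ[lam']
      fun x => g x * √((lam.rnDeriv lam' x).toReal) := by
  have h1 : f =ᵐ[lam] g ↔ ∀ᵐ x ∂lam', lam.rnDeriv lam' x ≠ 0 → f x = g x := by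
    conv_lhs => rw [← Measure.withDensity_rnDeriv_eq lam lam' h]
    exact ae_withDensity_iff (Measure.measurable_rnDeriv _ _)
  rw [h1]
  constructor
  · intro H
    filter_upwards [H] with x hx
    by_cases h0 : lam.rnDeriv lam' x = 0
    · simp [h0]
    · rw [hx h0]
  · intro H
    filter_upwards [H, Measure.rnDeriv_lt_top lam lam'] with x hx hlt h0
    refine mul_right_cancel₀ ?_ hx
    exact (Real.sqrt_pos.2 (ENNReal.toReal_pos h0 hlt.ne)).ne'

theorem dens_eq_mono (p q : Pair X) {lam lam' : Measure X} [SigmaFinite lam] [SigmaFinite lam']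
    (hp : p.μ ≪ lam) (hq : q.μ ≪ lam) (h : lam ≪ lam') :
    p.dens lam =ᵐ[lam] q.dens lam ↔ p.dens lam' =ᵐ[lam'] q.dens lam' := by
  rw [ae_eq_iff_mul_sqrt h]
  constructor
  · intro H
    exact (p.dens_chain hp).trans (H.trans (q.dens_chain hq).symm)
  · intro H
    exact (p.dens_chain hp).symm.trans (H.trans (q.dens_chain hq))

/-- The equivalence of pairs may be tested with any dominating measure. -/
theorem rel_iff (p q : Pair X) {lam : Measure X} [SigmaFinite lam]
    (hp : p.μ ≪ lam) (hq : q.μ ≪ lam) : Rel p q ↔ p.dens lam =ᵐ[lam] q.dens lam := by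
  constructor
  · rintro ⟨lam', hs, hp', hq', H⟩
    have h1 : lam ≪ lam + lam' := Measure.AbsolutelyContinuous.rfl.add_right _
    have h2 : lam' ≪ lam + lam' := by
      rw [add_comm]; exact Measure.AbsolutelyContinuous.rfl.add_right _
    rw [dens_eq_mono p q hp hq h1, ← dens_eq_mono p q hp' hq' h2]
    exact H
  · intro H
    exact ⟨lam, inferInstance, hp, hq, H⟩

instance setoid (X : Type*) [MeasurableSpace X] : Setoid (Pair X) where
  r := Rel
  iseqv :=
    { refl := fun p =>
        ⟨p.μ, inferInstance, Measure.AbsolutelyContinuous.rfl, Measure.AbsolutelyContinuous.rfl,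
          EventuallyEq.rfl⟩
      symm := fun ⟨lam, hs, hp, hq, H⟩ => ⟨lam, hs, hq, hp, H.symm⟩
      trans := by
        intro p q r hpq hqr
        have hp : p.μ ≪ p.μ + q.μ + r.μ :=
          (Measure.AbsolutelyContinuous.rfl.add_right _).add_right _
        have hq : q.μ ≪ p.μ + q.μ + r.μ := by
          rw [add_comm p.μ]; exact (Measure.AbsolutelyContinuous.rfl.add_right _).add_right _
        have hr : r.μ ≪ p.μ + q.μ + r.μ := by
          rw [add_comm]; exact Measure.AbsolutelyContinuous.rfl.add_right _
        exact (rel_iff p r hp hr).2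
          (((rel_iff p q hp hq).1 hpq).trans ((rel_iff q r hq hr).1 hqr)) }

theorem integrable_dens_mul (p q : Pair X) {lam : Measure X}
    (hp : MemLp (p.dens lam) 2 lam) (hq : MemLp (q.dens lam) 2 lam) :
    Integrable (fun x => p.dens lam x * q.dens lam x) lam := by
  exact hp.integrable_mul hq

theorem memLp_dens (p : Pair X) {lam : Measure X} [SigmaFinite lam] (hp : p.μ ≪ lam) :
    MemLp (p.dens lam) 2 lam := by
  rw [memLp_two_iff_integrable_sq (p.measurable_dens lam).aestronglyMeasurable]
  have h : Integrable (fun x => p.f x ^ 2) p.μ := p.memLp.integrable_sq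
  have := (integrable_rnDeriv_smul_iff hp (f := fun x => p.f x ^ 2)).2 h
  refine this.congr (Eventually.of_forall fun x => ?_)
  simp only [dens, smul_eq_mul, mul_pow, Real.sq_sqrt ENNReal.toReal_nonneg]
  ring

/-- `∫ f √(dμ/dlam) g √(dν/dlam) dlam`. -/
def innerAt (p q : Pair X) (lam : Measure X) : ℝ := ∫ x, p.dens lam x * q.dens lam x ∂lam

theorem innerAt_mono (p q : Pair X) {lam lam' : Measure X} [SigmaFinite lam] [SigmaFinite lam']
    (hp : p.μ ≪ lam) (hq : q.μ ≪ lam) (h : lam ≪ lam') :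
    innerAt p q lam' = innerAt p q lam := by
  unfold innerAt
  rw [← integral_rnDeriv_smul h]
  apply integral_congr_ae
  filter_upwards [p.dens_chain (lam' := lam') hp, q.dens_chain (lam' := lam') hq] with x h1 h2
  rw [h1, h2, smul_eq_mul]
  have := Real.mul_self_sqrt (ENNReal.toReal_nonneg (a := lam.rnDeriv lam' x))
  calc _ = (√((lam.rnDeriv lam' x).toReal) * √((lam.rnDeriv lam' x).toReal)) *
        (p.dens lam x * q.dens lam x) := by ring
    _ = _ := by rw [this]

/-- The inner product does not depend on the dominating measure. -/
theorem innerAt_indep (p q : Pair X) {lam lam' : Measure X} [SigmaFinite lam] [SigmaFinite lam']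
    (hp : p.μ ≪ lam) (hq : q.μ ≪ lam) (hp' : p.μ ≪ lam') (hq' : q.μ ≪ lam') :
    innerAt p q lam = innerAt p q lam' := by
  have h1 : lam ≪ lam + lam' := Measure.AbsolutelyContinuous.rfl.add_right _
  have h2 : lam' ≪ lam + lam' := by
    rw [add_comm]; exact Measure.AbsolutelyContinuous.rfl.add_right _
  rw [← innerAt_mono p q hp hq h1, ← innerAt_mono p q hp' hq' h2]

theorem ac_left (μ ν : Measure X) : μ ≪ μ + ν := Measure.AbsolutelyContinuous.rfl.add_right _

theorem ac_right (μ ν : Measure X) : ν ≪ μ + ν := by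
  rw [add_comm]; exact Measure.AbsolutelyContinuous.rfl.add_right _

/-- `(f, μ) + (g, ν) = (f √(dμ/dlam) + g √(dν/dlam), lam)` with `lam = μ + ν`. -/
def add (p q : Pair X) : Pair X where
  f x := p.dens (p.μ + q.μ) x + q.dens (p.μ + q.μ) x
  μ := p.μ + q.μ
  sigmaFinite := inferInstance
  measurable := (p.measurable_dens _).add (q.measurable_dens _)
  memLp := (p.memLp_dens (ac_left _ _)).add (q.memLp_dens (ac_right _ _))

/-- `c (f, μ) = (c f, μ)`. -/
def smul (c : ℝ) (p : Pair X) : Pair X where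
  f x := c * p.f x
  μ := p.μ
  sigmaFinite := inferInstance
  measurable := p.measurable.const_mul c
  memLp := p.memLp.const_mul c

/-- The pair `(0, 0)`. -/
def zero (X : Type*) [MeasurableSpace X] : Pair X where
  f _ := 0
  μ := 0
  sigmaFinite := inferInstance
  measurable := measurable_const
  memLp := by simp

theorem dens_add (p q : Pair X) {lam : Measure X} [SigmaFinite lam]
    (hp : p.μ ≪ lam) (hq : q.μ ≪ lam) :
    (p.add q).dens lam =ᵐ[lam] fun x => p.dens lam x + q.dens lam x := by
  filter_upwards [p.dens_chain (lam' := lam) (ac_left p.μ q.μ),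
    q.dens_chain (lam' := lam) (ac_right p.μ q.μ)] with x h1 h2
  rw [h1, h2, ← add_mul]
  rfl

theorem dens_smul (c : ℝ) (p : Pair X) (lam : Measure X) (x : X) :
    (smul c p).dens lam x = c * p.dens lam x := mul_assoc _ _ _

theorem dens_zero (lam : Measure X) (x : X) : (zero X).dens lam x = 0 := zero_mul _

theorem add_ac (p q : Pair X) {lam : Measure X} (hp : p.μ ≪ lam) (hq : q.μ ≪ lam) :
    (p.add q).μ ≪ lam := hp.add_left hq

end Pair

/-- The universal Hilbert space `H(X)`: equivalence classes `f √dμ` of pairs `(f, μ)`. -/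
def UniversalHilbert (X : Type*) [MeasurableSpace X] : Type _ := Quotient (Pair.setoid X)

namespace UniversalHilbert

variable {X : Type*} [MeasurableSpace X]

/-- The class `f √dμ` of a pair `(f, μ)`. -/
def mk (p : Pair X) : UniversalHilbert X := Quotient.mk _ p

theorem mk_surj (v : UniversalHilbert X) : ∃ p, mk p = v := Quotient.exists_rep v

theorem mk_eq_mk {p q : Pair X} {lam : Measure X} [SigmaFinite lam]
    (hp : p.μ ≪ lam) (hq : q.μ ≪ lam) : mk p = mk q ↔ p.dens lam =ᵐ[lam] q.dens lam :=
  Quotient.eq.trans (Pair.rel_iff p q hp hq)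

theorem rel_dens {p q : Pair X} (h : p ≈ q) {lam : Measure X} [SigmaFinite lam]
    (hp : p.μ ≪ lam) (hq : q.μ ≪ lam) : p.dens lam =ᵐ[lam] q.dens lam :=
  (Pair.rel_iff p q hp hq).1 h

instance : Zero (UniversalHilbert X) := ⟨mk (Pair.zero X)⟩

instance : Add (UniversalHilbert X) :=
  ⟨Quotient.map₂ Pair.add (by
    intro p p' hp q q' hq
    have a1 := Pair.ac_left p.μ (p'.μ + (q.μ + q'.μ))
    have a2 := (Pair.ac_left p'.μ (q.μ + q'.μ)).trans (Pair.ac_right p.μ _)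
    have a3 := ((Pair.ac_left q.μ q'.μ).trans (Pair.ac_right p'.μ _)).trans (Pair.ac_right p.μ _)
    have a4 := ((Pair.ac_right q.μ q'.μ).trans (Pair.ac_right p'.μ _)).trans (Pair.ac_right p.μ _)
    refine (Pair.rel_iff _ _ (Pair.add_ac p q a1 a3) (Pair.add_ac p' q' a2 a4)).2 ?_
    filter_upwards [Pair.dens_add p q a1 a3, Pair.dens_add p' q' a2 a4, rel_dens hp a1 a2,
      rel_dens hq a3 a4] with x h1 h2 h3 h4
    rw [h1, h2, h3, h4])⟩

instance : SMul ℝ (UniversalHilbert X) :=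
  ⟨fun c => Quotient.map (Pair.smul c) (by
    intro p q h
    have a1 := Pair.ac_left p.μ q.μ
    have a2 := Pair.ac_right p.μ q.μ
    refine (Pair.rel_iff (Pair.smul c p) (Pair.smul c q) a1 a2).2 ?_
    filter_upwards [rel_dens h a1 a2] with x h1
    rw [Pair.dens_smul, Pair.dens_smul, h1])⟩

instance : Neg (UniversalHilbert X) := ⟨fun v => (-1 : ℝ) • v⟩

theorem mk_add (p q : Pair X) : mk p + mk q = mk (p.add q) := rfl

theorem mk_smul (c : ℝ) (p : Pair X) : c • mk p = mk (p.smul c) := rfl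

theorem mk_zero : (0 : UniversalHilbert X) = mk (Pair.zero X) := rfl

theorem neg_def (v : UniversalHilbert X) : -v = (-1 : ℝ) • v := rfl

theorem zero_ac (lam : Measure X) : (Pair.zero X).μ ≪ lam :=
  Measure.AbsolutelyContinuous.zero lam

theorem smul_ac (c : ℝ) (p : Pair X) {lam : Measure X} (h : p.μ ≪ lam) : (p.smul c).μ ≪ lam := h

instance : AddCommGroup (UniversalHilbert X) where
  add_assoc u v w := by
    obtain ⟨p, rfl⟩ := mk_surj u
    obtain ⟨q, rfl⟩ := mk_surj v
    obtain ⟨r, rfl⟩ := mk_surj w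
    have a1 := Pair.ac_left p.μ (q.μ + r.μ)
    have a2 := (Pair.ac_left q.μ r.μ).trans (Pair.ac_right p.μ _)
    have a3 := (Pair.ac_right q.μ r.μ).trans (Pair.ac_right p.μ _)
    have b1 := Pair.add_ac p q a1 a2
    have b2 := Pair.add_ac q r a2 a3
    rw [mk_add, mk_add, mk_add, mk_add, mk_eq_mk (Pair.add_ac _ _ b1 a3) (Pair.add_ac _ _ a1 b2)]
    filter_upwards [Pair.dens_add _ _ b1 a3, Pair.dens_add _ _ a1 b2, Pair.dens_add _ _ a1 a2,
      Pair.dens_add _ _ a2 a3] with x h1 h2 h3 h4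
    rw [h1, h2, h3, h4, add_assoc]
  zero_add u := by
    obtain ⟨p, rfl⟩ := mk_surj u
    have a1 := Measure.AbsolutelyContinuous.refl p.μ
    rw [mk_zero, mk_add, mk_eq_mk (Pair.add_ac _ _ (zero_ac _) a1) a1]
    filter_upwards [Pair.dens_add _ _ (zero_ac _) a1] with x h1
    rw [h1, Pair.dens_zero, zero_add]
  add_zero u := by
    obtain ⟨p, rfl⟩ := mk_surj u
    have a1 := Measure.AbsolutelyContinuous.refl p.μ
    rw [mk_zero, mk_add, mk_eq_mk (Pair.add_ac _ _ a1 (zero_ac _)) a1]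
    filter_upwards [Pair.dens_add _ _ a1 (zero_ac _)] with x h1
    rw [h1, Pair.dens_zero, add_zero]
  nsmul := nsmulRec
  zsmul := zsmulRec
  neg_add_cancel u := by
    obtain ⟨p, rfl⟩ := mk_surj u
    have a1 := Measure.AbsolutelyContinuous.refl p.μ
    have a2 := smul_ac (-1) p a1
    rw [neg_def, mk_smul, mk_add, mk_zero, mk_eq_mk (Pair.add_ac _ _ a2 a1) (zero_ac _)]
    filter_upwards [Pair.dens_add _ _ a2 a1] with x h1
    rw [h1, Pair.dens_zero, Pair.dens_smul]
    ring
  add_comm u v := by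
    obtain ⟨p, rfl⟩ := mk_surj u
    obtain ⟨q, rfl⟩ := mk_surj v
    have a1 := Pair.ac_left p.μ q.μ
    have a2 := Pair.ac_right p.μ q.μ
    rw [mk_add, mk_add, mk_eq_mk (Pair.add_ac _ _ a1 a2) (Pair.add_ac _ _ a2 a1)]
    filter_upwards [Pair.dens_add _ _ a1 a2, Pair.dens_add _ _ a2 a1] with x h1 h2
    rw [h1, h2, add_comm]

instance : Module ℝ (UniversalHilbert X) where
  one_smul u := by
    obtain ⟨p, rfl⟩ := mk_surj u
    have a1 := Measure.AbsolutelyContinuous.refl p.μ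
    rw [mk_smul, mk_eq_mk (smul_ac _ p a1) a1]
    exact Eventually.of_forall fun x => by rw [Pair.dens_smul, one_mul]
  mul_smul c d u := by
    obtain ⟨p, rfl⟩ := mk_surj u
    have a1 := Measure.AbsolutelyContinuous.refl p.μ
    rw [mk_smul, mk_smul, mk_smul, mk_eq_mk (smul_ac _ p a1) (smul_ac _ _ (smul_ac _ p a1))]
    exact Eventually.of_forall fun x => by
      rw [Pair.dens_smul, Pair.dens_smul, Pair.dens_smul, mul_assoc]
  smul_zero c := by
    rw [mk_zero, mk_smul, mk_eq_mk (smul_ac _ _ (zero_ac 0)) (zero_ac 0)]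
    exact Eventually.of_forall fun x => by
      rw [Pair.dens_smul, Pair.dens_zero, mul_zero]
  zero_smul u := by
    obtain ⟨p, rfl⟩ := mk_surj u
    have a1 := Measure.AbsolutelyContinuous.refl p.μ
    rw [mk_zero, mk_smul, mk_eq_mk (smul_ac _ p a1) (zero_ac _)]
    exact Eventually.of_forall fun x => by rw [Pair.dens_smul, Pair.dens_zero, zero_mul]
  smul_add c u v := by
    obtain ⟨p, rfl⟩ := mk_surj u
    obtain ⟨q, rfl⟩ := mk_surj v
    have a1 := Pair.ac_left p.μ q.μ
    have a2 := Pair.ac_right p.μ q.μ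
    have b1 := smul_ac c p a1
    have b2 := smul_ac c q a2
    rw [mk_add, mk_smul, mk_smul, mk_smul, mk_add,
      mk_eq_mk (smul_ac c _ (Pair.add_ac _ _ a1 a2)) (Pair.add_ac _ _ b1 b2)]
    filter_upwards [Pair.dens_add _ _ a1 a2, Pair.dens_add _ _ b1 b2] with x h1 h2
    rw [Pair.dens_smul, h1, h2, Pair.dens_smul, Pair.dens_smul, mul_add]
  add_smul c d u := by
    obtain ⟨p, rfl⟩ := mk_surj u
    have a1 := Measure.AbsolutelyContinuous.refl p.μ
    have b1 := smul_ac c p a1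
    have b2 := smul_ac d p a1
    rw [mk_smul, mk_smul, mk_smul, mk_add, mk_eq_mk (smul_ac _ p a1) (Pair.add_ac _ _ b1 b2)]
    filter_upwards [Pair.dens_add _ _ b1 b2] with x h2
    rw [Pair.dens_smul, h2, Pair.dens_smul, Pair.dens_smul, add_mul]

theorem innerAt_congr {p p' q q' : Pair X} {lam : Measure X}
    (h : p.dens lam =ᵐ[lam] p'.dens lam) (h' : q.dens lam =ᵐ[lam] q'.dens lam) :
    p.innerAt q lam = p'.innerAt q' lam := by
  apply integral_congr_ae
  filter_upwards [h, h'] with x h1 h2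
  rw [h1, h2]

/-- `⟨f √dμ, g √dν⟩ = ∫ f g √(dμ/dlam) √(dν/dlam) dlam` with `lam = μ + ν`. -/
def innerFun (u v : UniversalHilbert X) : ℝ :=
  Quotient.liftOn₂ u v (fun p q => p.innerAt q (p.μ + q.μ)) (by
    intro p q p' q' hp hq
    have a1 := Pair.ac_left p.μ (p'.μ + (q.μ + q'.μ))
    have a2 := (Pair.ac_left p'.μ (q.μ + q'.μ)).trans (Pair.ac_right p.μ _)
    have a3 := ((Pair.ac_left q.μ q'.μ).trans (Pair.ac_right p'.μ _)).trans (Pair.ac_right p.μ _)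
    have a4 := ((Pair.ac_right q.μ q'.μ).trans (Pair.ac_right p'.μ _)).trans (Pair.ac_right p.μ _)
    change p.innerAt q (p.μ + q.μ) = p'.innerAt q' (p'.μ + q'.μ)
    rw [Pair.innerAt_indep p q (Pair.ac_left _ _) (Pair.ac_right _ _) a1 a3,
      Pair.innerAt_indep p' q' (Pair.ac_left _ _) (Pair.ac_right _ _) a2 a4]
    exact innerAt_congr (rel_dens hp a1 a2) (rel_dens hq a3 a4))

theorem innerFun_mk (p q : Pair X) {lam : Measure X} [SigmaFinite lam]
    (hp : p.μ ≪ lam) (hq : q.μ ≪ lam) :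
    innerFun (mk p) (mk q) = ∫ x, p.dens lam x * q.dens lam x ∂lam :=
  Pair.innerAt_indep p q (Pair.ac_left _ _) (Pair.ac_right _ _) hp hq

instance core : InnerProductSpace.Core ℝ (UniversalHilbert X) where
  inner := innerFun
  conj_inner_symm u v := by
    obtain ⟨p, rfl⟩ := mk_surj u
    obtain ⟨q, rfl⟩ := mk_surj v
    have a1 := Pair.ac_left p.μ q.μ
    have a2 := Pair.ac_right p.μ q.μ
    change innerFun (mk q) (mk p) = innerFun (mk p) (mk q)
    rw [innerFun_mk _ _ a1 a2, innerFun_mk _ _ a2 a1]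
    exact integral_congr_ae (Eventually.of_forall fun x => mul_comm _ _)
  re_inner_nonneg u := by
    obtain ⟨p, rfl⟩ := mk_surj u
    have a1 := Measure.AbsolutelyContinuous.refl p.μ
    change 0 ≤ innerFun (mk p) (mk p)
    rw [innerFun_mk _ _ a1 a1]
    exact integral_nonneg fun x => mul_self_nonneg _
  add_left u v w := by
    obtain ⟨p, rfl⟩ := mk_surj u
    obtain ⟨q, rfl⟩ := mk_surj v
    obtain ⟨r, rfl⟩ := mk_surj w
    have a1 := Pair.ac_left p.μ (q.μ + r.μ)
    have a2 := (Pair.ac_left q.μ r.μ).trans (Pair.ac_right p.μ _)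
    have a3 := (Pair.ac_right q.μ r.μ).trans (Pair.ac_right p.μ _)
    change innerFun (mk p + mk q) (mk r) = innerFun (mk p) (mk r) + innerFun (mk q) (mk r)
    rw [mk_add, innerFun_mk _ _ (Pair.add_ac _ _ a1 a2) a3, innerFun_mk _ _ a1 a3,
      innerFun_mk _ _ a2 a3, ← integral_add
        (Pair.integrable_dens_mul _ _ (p.memLp_dens a1) (r.memLp_dens a3))
        (Pair.integrable_dens_mul _ _ (q.memLp_dens a2) (r.memLp_dens a3))]
    apply integral_congr_ae
    filter_upwards [Pair.dens_add _ _ a1 a2] with x h1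
    rw [h1, add_mul]
  smul_left u v c := by
    obtain ⟨p, rfl⟩ := mk_surj u
    obtain ⟨q, rfl⟩ := mk_surj v
    have a1 := Pair.ac_left p.μ q.μ
    have a2 := Pair.ac_right p.μ q.μ
    change innerFun (c • mk p) (mk q) = c * innerFun (mk p) (mk q)
    rw [mk_smul, innerFun_mk _ _ (smul_ac c p a1) a2, innerFun_mk _ _ a1 a2,
      ← integral_const_mul]
    refine integral_congr_ae (Eventually.of_forall fun x => ?_)
    simp only [Pair.dens_smul, mul_assoc]
  definite u h := by
    obtain ⟨p, rfl⟩ := mk_surj u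
    have a1 := Measure.AbsolutelyContinuous.refl p.μ
    replace h : innerFun (mk p) (mk p) = 0 := h
    rw [innerFun_mk _ _ a1 a1, integral_eq_zero_iff_of_nonneg (fun x => mul_self_nonneg _)
      (Pair.integrable_dens_mul _ _ (p.memLp_dens a1) (p.memLp_dens a1))] at h
    rw [mk_zero, mk_eq_mk a1 (zero_ac _)]
    filter_upwards [h] with x hx
    rw [Pair.dens_zero]
    exact mul_self_eq_zero.1 hx

instance : NormedAddCommGroup (UniversalHilbert X) :=
  (core (X := X)).toNormedAddCommGroup

instance : InnerProductSpace ℝ (UniversalHilbert X) :=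
  InnerProductSpace.ofCore (core (X := X)).toCore

theorem inner_mk (p q : Pair X) {lam : Measure X} [SigmaFinite lam]
    (hp : p.μ ≪ lam) (hq : q.μ ≪ lam) :
    inner ℝ (mk p) (mk q) = ∫ x, p.dens lam x * q.dens lam x ∂lam :=
  innerFun_mk p q hp hq

theorem norm_mk_sub (p q : Pair X) {lam : Measure X} [SigmaFinite lam]
    (hp : p.μ ≪ lam) (hq : q.μ ≪ lam) :
    ‖mk p - mk q‖ = ‖(p.memLp_dens hp).toLp - (q.memLp_dens hq).toLp‖ := by
  have h1 : mk p - mk q = mk (p.add (q.smul (-1))) := by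
    rw [sub_eq_add_neg, neg_def, mk_smul, mk_add]
  have a := Pair.add_ac p _ hp (smul_ac (-1) q hq)
  rw [← sq_eq_sq₀ (norm_nonneg _) (norm_nonneg _), ← real_inner_self_eq_norm_sq,
    ← real_inner_self_eq_norm_sq, h1, inner_mk _ _ a a, L2.inner_def]
  apply integral_congr_ae
  filter_upwards [Pair.dens_add p _ hp (smul_ac (-1) q hq),
    Lp.coeFn_sub (p.memLp_dens hp).toLp (q.memLp_dens hq).toLp,
    (p.memLp_dens hp).coeFn_toLp, (q.memLp_dens hq).coeFn_toLp] with x h2 h3 h4 h5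
  rw [h2, h3, Pi.sub_apply, h4, h5, Pair.dens_smul]
  simp only [RCLike.inner_apply, conj_trivial]
  ring

instance : CompleteSpace (UniversalHilbert X) := by
  refine Metric.complete_of_cauchySeq_tendsto fun u hu => ?_
  choose p hp using fun n => mk_surj (u n)
  let lam : Measure X := (Measure.sum fun n => (p n).μ).toFinite
  have hac : ∀ n, (p n).μ ≪ lam := fun n =>
    (Measure.absolutelyContinuous_sum_right n Measure.AbsolutelyContinuous.rfl).trans
      (absolutelyContinuous_toFinite _)
  let g : ℕ → Lp ℝ 2 lam := fun n => ((p n).memLp_dens (hac n)).toLp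
  have hg : CauchySeq g := by
    rw [Metric.cauchySeq_iff] at hu ⊢
    intro ε hε
    obtain ⟨N, hN⟩ := hu ε hε
    refine ⟨N, fun m hm n hn => ?_⟩
    have := hN m hm n hn
    rwa [← hp m, ← hp n, dist_eq_norm, norm_mk_sub _ _ (hac m) (hac n), ← dist_eq_norm] at this
  obtain ⟨G, hG⟩ := cauchySeq_tendsto_of_complete hg
  have hGm := (Lp.aestronglyMeasurable G).aemeasurable
  let q : Pair X :=
    { f := hGm.mk G
      μ := lam
      sigmaFinite := inferInstance
      measurable := hGm.measurable_mk
      memLp := (memLp_congr_ae hGm.ae_eq_mk).1 (Lp.memLp G) }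
  have hq : q.μ ≪ lam := Measure.AbsolutelyContinuous.rfl
  have hqG : (q.memLp_dens hq).toLp = G := by
    apply Lp.ext
    filter_upwards [(q.memLp_dens hq).coeFn_toLp, hGm.ae_eq_mk, Measure.rnDeriv_self lam]
      with x h1 h2 h3
    rw [h1, h2]
    change hGm.mk G x * √((lam.rnDeriv lam x).toReal) = _
    rw [h3]
    simp
  refine ⟨mk q, ?_⟩
  rw [tendsto_iff_norm_sub_tendsto_zero] at hG ⊢
  refine hG.congr fun n => ?_
  rw [← hp n, norm_mk_sub _ _ (hac n) hq, hqG]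

/-- `v.IsClass f μ` says that `(f, μ)` is a pair (`μ` is σ-finite, `f` is Borel and `f ∈ L²(μ)`)
and that `v = f √dμ`. -/
def IsClass (v : UniversalHilbert X) (f : X → ℝ) (μ : Measure X) : Prop :=
  ∃ p : Pair X, p.f = f ∧ p.μ = μ ∧ mk p = v

/-- For a set `G` of measures, the closed span `H_G` of the subspaces
`H(μ) = {f √dμ | f ∈ L²(μ)}`, `μ ∈ G`. -/
def closedSpan (G : Set (Measure X)) : Submodule ℝ (UniversalHilbert X) :=
  (Submodule.span ℝ {v | ∃ μ ∈ G, ∃ f : X → ℝ, v.IsClass f μ}).topologicalClosure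

end UniversalHilbert

namespace TransferOperator

variable {X : Type*} [MeasurableSpace X]

/-- The defining property of `Ŝ`: `Ŝ (f √dμ) = (f ∘ σ) √d(μR)` for all Borel probability
measures `μ` and all `f ∈ L²(μ)`. -/
def IsSHat (T : TransferOperator X) (S : UniversalHilbert X → UniversalHilbert X) : Prop :=
  ∀ (v : UniversalHilbert X) (f : X → ℝ) (μ : Measure X), IsProbabilityMeasure μ →
    v.IsClass f μ → (S v).IsClass (f ∘ T.σ) (T.act μ)

/-- The defining property of `R̂`: `R̂ (f √dμ) = R(f) √d(μ ∘ σ⁻¹)` for all `μ ∈ K₁` and all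
`f ∈ L²(μ)`, and `R̂ = 0` on the orthogonal complement of `H_{K₁}`. -/
structure IsRHat (T : TransferOperator X) (R' : UniversalHilbert X → UniversalHilbert X) :
    Prop where
  of_K₁ : ∀ (v : UniversalHilbert X) (f : BorelFun X) (μ : Measure X), μ ∈ T.K₁ →
    v.IsClass f.1 μ → (R' v).IsClass (T.R f).1 (μ.map T.σ)
  of_orthogonal : ∀ v ∈ (UniversalHilbert.closedSpan T.K₁)ᗮ, R' v = 0

end TransferOperator

end

end UHS

/-!
A positive linear functional on the space of all Borel functions is integration against a finite
measure, because a cut-off of `f` at height `1/ε` costs at most `ε f²` and `f²` is again a Borel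
function. Hence `R` is integration against a kernel `x ↦ δ_x R`, and `μ ↦ μR` is the action of that
kernel on measures. By the pull-out property the kernel is concentrated on the fibres of `σ`, so
`σ` maps `μR` to `μ`, and `d(μR)/d(νR) = (dμ/dν) ∘ σ` whenever `μ ≪ ν`.

It follows that `f √dμ ↦ (f ∘ σ) √d(μR)` preserves inner products, so it extends to a linear
isometry `Ŝ`. By the pull-out property its adjoint sends `f √d(νR)` to `R(f) √dν`, and it vanishes
on the orthogonal complement of `H_{K₁}`, which contains the range of `Ŝ`: this adjoint is `R̂`.

Every element of `H(X)` is of the form `f √dμ` with `μ` a probability measure, which makes `Ŝ`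
unique. For `R̂`, any sequence of measures in `K₁` is dominated by a member of `K₁`, so each element
of the closed span `H_{K₁}`, being a limit of a sequence of finite sums, is a single class `f √dμ`
with `μ ∈ K₁`.
-/

namespace UHS

open ProbabilityTheory

section ClosedSpan

variable {𝕜 E : Type*} [Semiring 𝕜] [AddCommMonoid E] [Module 𝕜 E] {W : Set E}

theorem span_subset_of_forall_seq_mem_submodule (hne : W.Nonempty)
    (hW : ∀ u : ℕ → E, (∀ n, u n ∈ W) → ∃ V : Submodule 𝕜 E, (∀ n, u n ∈ V) ∧ ↑V ⊆ W) :
    (Submodule.span 𝕜 W : Set E) ⊆ W := by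
  intro w hw
  induction hw using Submodule.span_induction with
  | mem _ hx => exact hx
  | zero =>
    obtain ⟨x, hx⟩ := hne
    obtain ⟨V, -, hVW⟩ := hW (fun _ => x) fun _ => hx
    exact hVW V.zero_mem
  | add x y _ _ hx hy =>
    obtain ⟨V, hV, hVW⟩ := hW (fun | 0 => x | _ + 1 => y) (by rintro (_ | _) <;> assumption)
    exact hVW (V.add_mem (hV 0) (hV 1))
  | smul c x _ hx =>
    obtain ⟨V, hV, hVW⟩ := hW (fun _ => x) fun _ => hx
    exact hVW (V.smul_mem c (hV 0))

theorem topologicalClosure_span_subset_of_forall_seq_mem_submodule [TopologicalSpace E]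
    [FrechetUrysohnSpace E] [ContinuousAdd E] [ContinuousConstSMul 𝕜 E] (hne : W.Nonempty)
    (hW : ∀ u : ℕ → E, (∀ n, u n ∈ W) →
      ∃ V : Submodule 𝕜 E, IsClosed (V : Set E) ∧ (∀ n, u n ∈ V) ∧ ↑V ⊆ W) :
    ((Submodule.span 𝕜 W).topologicalClosure : Set E) ⊆ W := by
  intro v hv
  have span_subset : (Submodule.span 𝕜 W : Set E) ⊆ W :=
    span_subset_of_forall_seq_mem_submodule hne fun u hu => (hW u hu).imp fun _ hV => hV.2
  obtain ⟨u, hu, hlim⟩ := mem_closure_iff_seq_limit.1 hv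
  obtain ⟨V, hVc, hV, hVW⟩ := hW u fun n => span_subset (hu n)
  exact hVW (hVc.mem_of_tendsto hlim (Eventually.of_forall hV))

end ClosedSpan

section LinearIsometry

variable {ι 𝕜 E F : Type*} [RCLike 𝕜] [NormedAddCommGroup E] [InnerProductSpace 𝕜 E]
  [NormedAddCommGroup F] [InnerProductSpace 𝕜 F]

theorem norm_linearCombination_eq_of_inner_eq {a : ι → E} {b : ι → F}
    (hab : ∀ i j, inner 𝕜 (b i) (b j) = inner 𝕜 (a i) (a j)) (c : ι →₀ 𝕜) :
    ‖Finsupp.linearCombination 𝕜 b c‖ = ‖Finsupp.linearCombination 𝕜 a c‖ := by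
  simp only [norm_eq_sqrt_re_inner (𝕜 := 𝕜), Finsupp.linearCombination_apply, Finsupp.sum_inner,
    Finsupp.inner_sum, inner_smul_left, inner_smul_right, hab]

theorem exists_linearIsometry_of_inner_eq {a : ι → E} {b : ι → F}
    (ha : Submodule.span 𝕜 (Set.range a) = ⊤)
    (hab : ∀ i j, inner 𝕜 (b i) (b j) = inner 𝕜 (a i) (a j)) :
    ∃ V : E →ₗᵢ[𝕜] F, ∀ i, V (a i) = b i := by
  have norm_eq := norm_linearCombination_eq_of_inner_eq hab
  obtain ⟨g, hg⟩ := (Finsupp.linearCombination 𝕜 a).exists_rightInverse_of_surjective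
    ((Finsupp.range_linearCombination 𝕜).trans ha)
  replace hg (e : E) : Finsupp.linearCombination 𝕜 a (g e) = e := LinearMap.congr_fun hg e
  refine ⟨⟨Finsupp.linearCombination 𝕜 b ∘ₗ g, fun e => ?_⟩, fun i => ?_⟩
  · rw [LinearMap.comp_apply, norm_eq, hg]
  · have hi := norm_eq (g (a i) - Finsupp.single i 1)
    rwa [map_sub, map_sub, hg, Finsupp.linearCombination_single, Finsupp.linearCombination_single,
      one_smul, one_smul, sub_self, norm_zero, norm_eq_zero, sub_eq_zero] at hi

end LinearIsometry

namespace BorelFun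

variable {X : Type*} [MeasurableSpace X]

theorem indic_nonneg {A : Set X} (hA : MeasurableSet A) (x : X) : 0 ≤ (indic A hA).1 x :=
  Set.indicator_nonneg (fun _ _ => zero_le_one) x

theorem indic_univ : indic Set.univ MeasurableSet.univ = oneFun X :=
  Subtype.ext (Set.indicator_univ _)

theorem exists_simpleFunc_abs_sub_le {f : X → ℝ} (hf : Measurable f) {M : ℝ}
    (hM : ∀ x, |f x| ≤ M) {ε : ℝ} (hε : 0 < ε) :
    ∃ s : SimpleFunc X ℝ, ∀ x, |f x - s x| ≤ ε := by
  let k : X → ℤ := fun x => ⌊f x / ε⌋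
  have finite_range : (Set.range k).Finite := by
    refine (Set.finite_Icc ⌊-M / ε⌋ ⌊M / ε⌋).subset ?_
    rintro _ ⟨x, rfl⟩
    obtain ⟨lower, upper⟩ := abs_le.1 (hM x)
    exact ⟨Int.floor_le_floor (by gcongr), Int.floor_le_floor (by gcongr)⟩
  let s : SimpleFunc X ℤ :=
    ⟨k, fun n => (hf.div_const ε).floor (measurableSet_singleton n), finite_range⟩
  refine ⟨s.map fun n : ℤ => ε * (n : ℝ), fun x => ?_⟩
  change |f x - ε * ⌊f x / ε⌋| ≤ ε
  have floor_le := (le_div_iff₀ hε).1 (Int.floor_le (f x / ε))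
  have lt_floor := (div_lt_iff₀ hε).1 (Int.lt_floor_add_one (f x / ε))
  rw [abs_le]
  constructor <;> linarith

theorem exists_simpleFunc_abs_sub_le_mul_sq {f : X → ℝ} (hf : Measurable f) {ε : ℝ} (hε : 0 < ε) :
    ∃ s : SimpleFunc X ℝ, ∀ x, |f x - s x| ≤ ε * (1 + f x ^ 2) := by
  let A : Set X := {x | |f x| ≤ ε⁻¹}
  have hA : MeasurableSet A := measurableSet_le hf.abs measurable_const
  have truncation_le (x : X) : |A.indicator f x| ≤ ε⁻¹ := by
    by_cases hx : x ∈ A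
    · rwa [Set.indicator_of_mem hx]
    · rw [Set.indicator_of_notMem hx, abs_zero]
      exact (inv_pos.2 hε).le
  have sub_truncation_le (x : X) : |f x - A.indicator f x| ≤ ε * f x ^ 2 := by
    by_cases hx : x ∈ A
    · rw [Set.indicator_of_mem hx, sub_self, abs_zero]
      positivity
    · rw [Set.indicator_of_notMem hx, sub_zero, ← sq_abs]
      have large : 1 ≤ ε * |f x| := (inv_le_iff_one_le_mul₀' hε).1 (not_le.1 hx).le
      nlinarith [abs_nonneg (f x)]
  obtain ⟨s, hs⟩ := exists_simpleFunc_abs_sub_le (hf.indicator hA) truncation_le hε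
  refine ⟨s, fun x => ?_⟩
  calc |f x - s x| ≤ |f x - A.indicator f x| + |A.indicator f x - s x| := abs_sub_le _ _ _
    _ ≤ ε * f x ^ 2 + ε := add_le_add (sub_truncation_le x) (hs x)
    _ = ε * (1 + f x ^ 2) := by ring

/-- Positivity of a linear functional on the space of Borel functions. Such a functional is
integration against a finite measure, see `IsPositive.eq_integral`. -/
def IsPositive (φ : BorelFun X →ₗ[ℝ] ℝ) : Prop :=
  ∀ f : BorelFun X, (∀ x, 0 ≤ f.1 x) → 0 ≤ φ f

namespace IsPositive

variable {φ : BorelFun X →ₗ[ℝ] ℝ} {m : Measure X}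

theorem mono (hφ : IsPositive φ) {f g : BorelFun X} (hfg : ∀ x, f.1 x ≤ g.1 x) : φ f ≤ φ g :=
  sub_nonneg.1 (map_sub φ g f ▸ hφ (g - f) fun x => sub_nonneg.2 (hfg x))

theorem abs_sub_le (hφ : IsPositive φ) {f g h : BorelFun X}
    (hfg : ∀ x, |f.1 x - g.1 x| ≤ h.1 x) : |φ f - φ g| ≤ φ h := by
  rw [abs_sub_le_iff, ← map_sub, ← map_sub]
  exact ⟨hφ.mono fun x => (abs_sub_le_iff.1 (hfg x)).1,
    hφ.mono fun x => (abs_sub_le_iff.1 (hfg x)).2⟩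

theorem isFiniteMeasure (hm : ∀ A hA, m A = ENNReal.ofReal (φ (indic A hA))) :
    IsFiniteMeasure m :=
  ⟨by rw [hm _ MeasurableSet.univ]; exact ENNReal.ofReal_lt_top⟩

theorem measureReal_eq (hφ : IsPositive φ) (hm : ∀ A hA, m A = ENNReal.ofReal (φ (indic A hA)))
    {A : Set X} (hA : MeasurableSet A) : m.real A = φ (indic A hA) := by
  rw [measureReal_def, hm A hA, ENNReal.toReal_ofReal (hφ _ (indic_nonneg hA))]

theorem simpleFunc_eq_integral (hφ : IsPositive φ)
    (hm : ∀ A hA, m A = ENNReal.ofReal (φ (indic A hA))) (s : SimpleFunc X ℝ) :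
    φ ⟨s, s.measurable⟩ = ∫ x, s x ∂m := by
  have := isFiniteMeasure hm
  induction s using SimpleFunc.induction with
  | @const c A hA =>
    have const_indicator (x : X) :
        SimpleFunc.piecewise A hA (SimpleFunc.const X c) (SimpleFunc.const X 0) x =
          A.indicator (fun _ => c) x := by
      by_cases hx : x ∈ A <;> simp [hx]
    have eq_smul : (⟨_, (SimpleFunc.piecewise A hA (SimpleFunc.const X c)
        (SimpleFunc.const X 0)).measurable⟩ : BorelFun X) = c • indic A hA := by
      ext x
      by_cases hx : x ∈ A <;> simp [indic, hx]
    simp only [const_indicator]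
    rw [eq_smul, map_smul, ← hφ.measureReal_eq hm hA, integral_indicator_const c hA, smul_eq_mul,
      smul_eq_mul, mul_comm]
  | @add s t _ hs ht =>
    simp only [SimpleFunc.coe_add, Pi.add_apply]
    rw [integral_add s.integrable_of_isFiniteMeasure t.integrable_of_isFiniteMeasure, ← hs, ← ht,
      ← map_add]
    rfl

theorem lintegral_le (hφ : IsPositive φ) (hm : ∀ A hA, m A = ENNReal.ofReal (φ (indic A hA)))
    {f : BorelFun X} (hf : ∀ x, 0 ≤ f.1 x) :
    ∫⁻ x, ENNReal.ofReal (f.1 x) ∂m ≤ ENNReal.ofReal (φ f) := by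
  have := isFiniteMeasure hm
  rw [lintegral_eq_nnreal]
  refine iSup₂_le fun s hs => ?_
  let t : SimpleFunc X ℝ := s.map (↑)
  have t_nonneg (x : X) : 0 ≤ t x := (s x).2
  have t_le (x : X) : t x ≤ f.1 x :=
    (ENNReal.le_ofReal_iff_toReal_le ENNReal.coe_ne_top (hf x)).1 (hs x)
  calc (s.map (↑)).lintegral m = ∫⁻ x, ENNReal.ofReal (t x) ∂m := by
        rw [← SimpleFunc.lintegral_eq_lintegral]
        simp [t]
    _ = ENNReal.ofReal (φ ⟨t, t.measurable⟩) := by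
        rw [hφ.simpleFunc_eq_integral hm, ofReal_integral_eq_lintegral_ofReal
          t.integrable_of_isFiniteMeasure (Eventually.of_forall t_nonneg)]
    _ ≤ ENNReal.ofReal (φ f) := ENNReal.ofReal_le_ofReal (hφ.mono t_le)

theorem integrable (hφ : IsPositive φ) (hm : ∀ A hA, m A = ENNReal.ofReal (φ (indic A hA)))
    (f : BorelFun X) : Integrable f.1 m := by
  refine ⟨f.2.aestronglyMeasurable, (hasFiniteIntegral_iff_norm _).2 ?_⟩
  exact (hφ.lintegral_le hm (f := ⟨fun x => ‖f.1 x‖, f.2.norm⟩) fun x => norm_nonneg _).trans_lt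
    ENNReal.ofReal_lt_top

/-- No continuity of `φ` is assumed: truncating `f` costs at most `ε f²`, and `f²` is again a Borel
function, on which `φ` is finite. -/
theorem eq_integral (hφ : IsPositive φ) (hm : ∀ A hA, m A = ENNReal.ofReal (φ (indic A hA)))
    (f : BorelFun X) : φ f = ∫ x, f.1 x ∂m := by
  have := isFiniteMeasure hm
  let g : BorelFun X := ⟨fun x => 1 + f.1 x ^ 2, (f.2.pow_const 2).const_add 1⟩
  have abs_sub_le_mul {ε : ℝ} (hε : 0 < ε) :
      |φ f - ∫ x, f.1 x ∂m| ≤ ε * (φ g + ∫ x, g.1 x ∂m) := by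
    obtain ⟨s, hs⟩ := exists_simpleFunc_abs_sub_le_mul_sq f.2 hε
    have functional_le : |φ f - φ ⟨s, s.measurable⟩| ≤ ε * φ g := by
      simpa only [map_smul, smul_eq_mul] using hφ.abs_sub_le (h := ε • g) hs
    have integral_le : |∫ x, s x ∂m - ∫ x, f.1 x ∂m| ≤ ε * ∫ x, g.1 x ∂m := by
      rw [abs_sub_comm, ← integral_sub (hφ.integrable hm f) s.integrable_of_isFiniteMeasure,
        ← integral_const_mul]
      exact norm_integral_le_of_norm_le (f := fun x => f.1 x - s x)
        ((hφ.integrable hm g).const_mul ε) (Eventually.of_forall hs)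
    rw [hφ.simpleFunc_eq_integral hm] at functional_le
    calc |φ f - ∫ x, f.1 x ∂m| ≤ _ := _root_.abs_sub_le _ (∫ x, s x ∂m) _
      _ ≤ _ := add_le_add functional_le integral_le
      _ = ε * (φ g + ∫ x, g.1 x ∂m) := (mul_add _ _ _).symm
  have tendsto_zero : Tendsto (fun ε => ε * (φ g + ∫ x, g.1 x ∂m)) (nhdsWithin 0 (Set.Ioi 0))
      (nhds 0) := by
    simpa only [zero_mul, id] using
      (tendsto_id'.2 (nhdsWithin_le_nhds (s := Set.Ioi (0 : ℝ)) (a := 0))).mul_const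
        (φ g + ∫ x, g.1 x ∂m)
  exact sub_eq_zero.1 (abs_nonpos_iff.1
    (ge_of_tendsto tendsto_zero (eventually_mem_nhdsWithin.mono fun _ hε => abs_sub_le_mul hε)))

end IsPositive

end BorelFun

namespace TransferOperator

variable {X : Type*} [MeasurableSpace X] (T : TransferOperator X)

theorem act_dirac_apply (x : X) {A : Set X} (hA : MeasurableSet A) :
    T.act (Measure.dirac x) A = ENNReal.ofReal ((T.R (indic A hA)).1 x) := by
  rw [T.act_apply _ hA, lintegral_dirac' _ (T.R (indic A hA)).2.ennreal_ofReal]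

/-- The kernel `x ↦ δ_x R` of a transfer operator: `R` is integration against it and `μ ↦ μR` is its
action on measures, see `R_apply_eq_integral` and `act_eq_comp`. -/
noncomputable def toKernel : Kernel X X where
  toFun x := T.act (Measure.dirac x)
  measurable' := Measure.measurable_of_measurable_coe _ fun A hA => by
    simp only [T.act_dirac_apply _ hA]
    exact (T.R (indic A hA)).2.ennreal_ofReal

theorem toKernel_apply (x : X) {A : Set X} (hA : MeasurableSet A) :
    T.toKernel x A = ENNReal.ofReal ((T.R (indic A hA)).1 x) :=
  T.act_dirac_apply x hA

theorem act_eq_comp (μ : Measure X) : T.act μ = T.toKernel ∘ₘ μ := by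
  ext A hA
  rw [T.act_apply _ hA, Measure.bind_apply hA T.toKernel.aemeasurable]
  exact lintegral_congr fun x => (T.toKernel_apply x hA).symm

theorem act_absolutelyContinuous {μ ν : Measure X} (h : μ ≪ ν) : T.act μ ≪ T.act ν := by
  rw [act_eq_comp, act_eq_comp]
  exact h.comp_right T.toKernel

theorem R_apply_eq_integral (f : BorelFun X) (x : X) :
    (T.R f).1 x = ∫ y, f.1 y ∂T.toKernel x := by
  have positive : BorelFun.IsPositive (LinearMap.proj x ∘ₗ (BorelFun X).subtype ∘ₗ T.R) :=
    fun g hg => T.nonneg g hg x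
  exact positive.eq_integral (fun _ hA => T.toKernel_apply x hA) f

theorem integral_act {μ : Measure X} {f : BorelFun X} (hf : Integrable f.1 (T.act μ)) :
    ∫ y, f.1 y ∂T.act μ = ∫ x, (T.R f).1 x ∂μ := by
  simp only [R_apply_eq_integral]
  rw [act_eq_comp] at hf ⊢
  exact Kernel.integral_comp (κ := Kernel.const Unit μ) (a := ()) hf

theorem integrable_R {μ : Measure X} {f : BorelFun X} (hf : Integrable f.1 (T.act μ)) :
    Integrable (T.R f).1 μ := by
  rw [act_eq_comp] at hf
  rw [funext (T.R_apply_eq_integral f)]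
  exact Integrable.integral_comp (κ := Kernel.const Unit μ) (a := ()) hf

theorem integral_comp_mul_act {μ : Measure X} {f g : BorelFun X}
    (hfg : Integrable (fun x => f.1 (T.σ x) * g.1 x) (T.act μ)) :
    ∫ x, f.1 (T.σ x) * g.1 x ∂T.act μ = ∫ x, f.1 x * (T.R g).1 x ∂μ := by
  let fσg : BorelFun X := ⟨fun x => f.1 (T.σ x) * g.1 x, (f.2.comp T.measurable_σ).mul g.2⟩
  calc ∫ x, fσg.1 x ∂T.act μ = ∫ x, (T.R fσg).1 x ∂μ := T.integral_act hfg
    _ = ∫ x, f.1 x * (T.R g).1 x ∂μ := by rw [T.pull_out]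

theorem toKernel_preimage_inter (x : X) {A B : Set X} (hA : MeasurableSet A)
    (hB : MeasurableSet B) :
    T.toKernel x (T.σ ⁻¹' B ∩ A) = T.toKernel x A * B.indicator 1 x := by
  have indic_inter : indic (T.σ ⁻¹' B ∩ A) ((T.measurable_σ hB).inter hA) =
      ⟨fun y => (indic B hB).1 (T.σ y) * (indic A hA).1 y,
        ((indic B hB).2.comp T.measurable_σ).mul (indic A hA).2⟩ := by
    ext y
    by_cases hyA : y ∈ A <;> by_cases hyB : T.σ y ∈ B <;> simp [indic, hyA, hyB]
  rw [T.toKernel_apply x ((T.measurable_σ hB).inter hA), T.toKernel_apply x hA, indic_inter,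
    T.pull_out]
  by_cases hx : x ∈ B <;> simp [indic, hx]

/-- The kernel is concentrated on the fibres of `σ`; stated through image measures, as singletons of
`X` need not be measurable. -/
theorem map_restrict_toKernel (x : X) {A : Set X} (hA : MeasurableSet A) :
    ((T.toKernel x).restrict A).map T.σ = T.toKernel x A • Measure.dirac x := by
  ext B hB
  rw [Measure.map_apply T.measurable_σ hB, Measure.restrict_apply (T.measurable_σ hB),
    T.toKernel_preimage_inter x hA hB, Measure.smul_apply, Measure.dirac_apply' x hB, smul_eq_mul]

theorem setLIntegral_comp_toKernel (x : X) {A : Set X} (hA : MeasurableSet A) {h : X → ℝ≥0∞}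
    (hh : Measurable h) :
    ∫⁻ y in A, h (T.σ y) ∂T.toKernel x = T.toKernel x A * h x := by
  rw [← lintegral_map hh T.measurable_σ, T.map_restrict_toKernel x hA, lintegral_smul_measure,
    lintegral_dirac' x hh, smul_eq_mul]

theorem act_withDensity (μ : Measure X) {h : X → ℝ≥0∞} (hh : Measurable h) :
    T.act (μ.withDensity h) = (T.act μ).withDensity (h ∘ T.σ) := by
  ext A hA
  rw [withDensity_apply _ hA, ← lintegral_indicator hA, act_eq_comp, act_eq_comp,
    Measure.lintegral_bind T.toKernel.aemeasurable
      ((hh.comp T.measurable_σ).indicator hA).aemeasurable,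
    Measure.bind_apply hA T.toKernel.aemeasurable,
    lintegral_withDensity_eq_lintegral_mul _ hh (T.toKernel.measurable_coe hA)]
  refine lintegral_congr fun x => ?_
  rw [lintegral_indicator hA, Pi.mul_apply, mul_comm]
  exact (T.setLIntegral_comp_toKernel x hA hh).symm

namespace Normalized

variable {T}

theorem R_sq_le (hT : T.Normalized) (f : BorelFun X) (x : X) :
    (T.R f).1 x ^ 2 ≤ (T.R ⟨fun y => f.1 y ^ 2, f.2.pow_const 2⟩).1 x := by
  set c := (T.R f).1 x with hc
  set fsq : BorelFun X := ⟨fun y => f.1 y ^ 2, f.2.pow_const 2⟩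
  have nonneg := T.nonneg (fsq - (2 * c) • f + c ^ 2 • oneFun X) (fun y => by
    have : 0 ≤ (f.1 y - c) ^ 2 := sq_nonneg _
    change 0 ≤ f.1 y ^ 2 - (2 * c) * f.1 y + c ^ 2 * 1
    linarith) x
  rw [map_add, map_sub, map_smul, map_smul, hT] at nonneg
  change 0 ≤ (T.R fsq).1 x - (2 * c) * (T.R f).1 x + c ^ 2 * 1 at nonneg
  rw [← hc] at nonneg
  linarith

theorem memLp_R (hT : T.Normalized) {ν : Measure X} {f : BorelFun X} (hf : MemLp f.1 2 (T.act ν)) :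
    MemLp (T.R f).1 2 ν := by
  rw [memLp_two_iff_integrable_sq (T.R f).2.aestronglyMeasurable]
  have integrable_sq : Integrable (T.R ⟨fun y => f.1 y ^ 2, f.2.pow_const 2⟩).1 ν :=
    T.integrable_R hf.integrable_sq
  refine integrable_sq.mono' ((T.R f).2.pow_const 2).aestronglyMeasurable
    (Eventually.of_forall fun x => ?_)
  rw [Real.norm_of_nonneg (sq_nonneg _)]
  exact hT.R_sq_le f x

theorem map_toKernel (hT : T.Normalized) (x : X) :
    (T.toKernel x).map T.σ = Measure.dirac x := by
  have toKernel_univ : T.toKernel x Set.univ = 1 := by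
    rw [T.toKernel_apply x MeasurableSet.univ, BorelFun.indic_univ, hT]
    exact ENNReal.ofReal_one
  simpa only [Measure.restrict_univ, toKernel_univ, one_smul] using
    T.map_restrict_toKernel x MeasurableSet.univ

theorem measurePreserving (hT : T.Normalized) (μ : Measure X) :
    MeasurePreserving T.σ (T.act μ) μ := by
  refine ⟨T.measurable_σ, ?_⟩
  have map_eq_id : T.toKernel.map T.σ = Kernel.id := by
    ext x : 1
    rw [Kernel.map_apply _ T.measurable_σ, hT.map_toKernel, Kernel.id_apply]
  rw [act_eq_comp, Measure.map_comp _ _ T.measurable_σ, map_eq_id, Measure.id_comp]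

theorem sigmaFinite_act (hT : T.Normalized) (μ : Measure X) [SigmaFinite μ] :
    SigmaFinite (T.act μ) :=
  SigmaFinite.of_map _ T.measurable_σ.aemeasurable
    (by rw [(hT.measurePreserving μ).map_eq]; infer_instance)

theorem rnDeriv_act (hT : T.Normalized) {μ ν : Measure X} [SigmaFinite μ] [SigmaFinite ν]
    (h : μ ≪ ν) :
    (T.act μ).rnDeriv (T.act ν) =ᵐ[T.act ν] μ.rnDeriv ν ∘ T.σ := by
  have := hT.sigmaFinite_act ν
  conv_lhs => rw [← Measure.withDensity_rnDeriv_eq μ ν h,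
    T.act_withDensity ν (Measure.measurable_rnDeriv μ ν)]
  exact Measure.rnDeriv_withDensity _ ((Measure.measurable_rnDeriv μ ν).comp T.measurable_σ)

end Normalized

end TransferOperator

theorem exists_isProbabilityMeasure_absolutelyContinuous {X : Type*} [MeasurableSpace X]
    [Nonempty X] (μ : Measure X) [SFinite μ] :
    ∃ ν : Measure X, IsProbabilityMeasure ν ∧ μ ≪ ν := by
  let κ : Measure X := μ + Measure.dirac (Classical.arbitrary X)
  have : NeZero κ := ⟨fun h => by simpa [κ] using congrArg (fun m : Measure X => m Set.univ) h⟩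
  exact ⟨κ.toFinite, inferInstance, (Pair.ac_left _ _).trans (absolutelyContinuous_toFinite κ)⟩

theorem Pair.dens_self {X : Type*} [MeasurableSpace X] (p : Pair X) : p.dens p.μ =ᵐ[p.μ] p.f := by
  filter_upwards [Measure.rnDeriv_self p.μ] with x hx
  rw [Pair.dens, hx, ENNReal.toReal_one, Real.sqrt_one, mul_one]

namespace UniversalHilbert

variable {X : Type*} [MeasurableSpace X]

instance [IsEmpty X] : Subsingleton (UniversalHilbert X) :=
  ⟨fun u v => by
    obtain ⟨p, rfl⟩ := mk_surj u
    obtain ⟨q, rfl⟩ := mk_surj v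
    exact (mk_eq_mk (Pair.ac_left p.μ q.μ) (Pair.ac_right p.μ q.μ)).2
      (Eventually.of_forall isEmptyElim)⟩

theorem IsClass.measurable {v : UniversalHilbert X} {f : X → ℝ} {μ : Measure X}
    (hv : v.IsClass f μ) : Measurable f := by
  obtain ⟨p, rfl, -, -⟩ := hv
  exact p.measurable

theorem IsClass.unique {v w : UniversalHilbert X} {f : X → ℝ} {μ : Measure X}
    (hv : v.IsClass f μ) (hw : w.IsClass f μ) : v = w := by
  obtain ⟨⟨_, _, _, _, _⟩, rfl, rfl, rfl⟩ := hv
  obtain ⟨⟨_, _, _, _, _⟩, ⟨⟩, ⟨⟩, rfl⟩ := hw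
  rfl

theorem isClass_mk_dens (p : Pair X) {lam : Measure X} [SigmaFinite lam] (h : p.μ ≪ lam) :
    (mk p).IsClass (p.dens lam) lam := by
  let q : Pair X := ⟨p.dens lam, lam, inferInstance, p.measurable_dens lam, p.memLp_dens h⟩
  exact ⟨q, rfl, rfl, (mk_eq_mk Measure.AbsolutelyContinuous.rfl h).2 q.dens_self⟩

theorem IsClass.exists_of_absolutelyContinuous {v : UniversalHilbert X} {f : X → ℝ}
    {μ lam : Measure X} [SigmaFinite lam] (hv : v.IsClass f μ) (h : μ ≪ lam) :
    ∃ g, v.IsClass g lam := by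
  obtain ⟨p, -, rfl, rfl⟩ := hv
  exact ⟨_, isClass_mk_dens p h⟩

theorem exists_isClass_isProbabilityMeasure [Nonempty X] (v : UniversalHilbert X) :
    ∃ (f : X → ℝ) (μ : Measure X), IsProbabilityMeasure μ ∧ v.IsClass f μ := by
  obtain ⟨p, rfl⟩ := mk_surj v
  obtain ⟨μ, hμ, h⟩ := exists_isProbabilityMeasure_absolutelyContinuous p.μ
  exact ⟨_, μ, hμ, isClass_mk_dens p h⟩

section ofLp

variable {lam : Measure X} [SigmaFinite lam]

/-- The pair `(f, lam)` of an element `f` of `L²(lam)`, for a Borel representative of `f`. -/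
noncomputable def pairOfLp (f : Lp ℝ 2 lam) : Pair X where
  f := (Lp.aestronglyMeasurable f).aemeasurable.mk f
  μ := lam
  sigmaFinite := inferInstance
  measurable := (Lp.aestronglyMeasurable f).aemeasurable.measurable_mk
  memLp := (memLp_congr_ae (Lp.aestronglyMeasurable f).aemeasurable.ae_eq_mk).1 (Lp.memLp f)

theorem dens_pairOfLp (f : Lp ℝ 2 lam) : (pairOfLp f).dens lam =ᵐ[lam] f :=
  (pairOfLp f).dens_self.trans (Lp.aestronglyMeasurable f).aemeasurable.ae_eq_mk.symm

theorem inner_mk_pairOfLp (f g : Lp ℝ 2 lam) :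
    inner ℝ (mk (pairOfLp f)) (mk (pairOfLp g)) = inner ℝ f g := by
  rw [inner_mk _ _ (Measure.AbsolutelyContinuous.refl lam) (Measure.AbsolutelyContinuous.refl lam),
    L2.inner_def]
  apply integral_congr_ae
  filter_upwards [dens_pairOfLp f, dens_pairOfLp g] with x hf hg
  rw [hf, hg, RCLike.inner_apply, conj_trivial, mul_comm]

theorem exists_linearIsometry_eq_mk_pairOfLp (lam : Measure X) [SigmaFinite lam] :
    ∃ V : Lp ℝ 2 lam →ₗᵢ[ℝ] UniversalHilbert X, ∀ f, V f = mk (pairOfLp f) :=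
  exists_linearIsometry_of_inner_eq (a := id) (by rw [Set.range_id, Submodule.span_univ])
    inner_mk_pairOfLp

variable (lam) in
/-- The isometric embedding `f ↦ f √dlam` of `L²(lam)` into the universal Hilbert space. -/
noncomputable def ofLp : Lp ℝ 2 lam →ₗᵢ[ℝ] UniversalHilbert X :=
  (exists_linearIsometry_eq_mk_pairOfLp lam).choose

theorem ofLp_apply (f : Lp ℝ 2 lam) : ofLp lam f = mk (pairOfLp f) :=
  (exists_linearIsometry_eq_mk_pairOfLp lam).choose_spec f

theorem mem_range_ofLp {v : UniversalHilbert X} :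
    v ∈ LinearMap.range (ofLp lam).toLinearMap ↔ ∃ f, v.IsClass f lam := by
  constructor
  · rintro ⟨f, rfl⟩
    exact ⟨_, pairOfLp f, rfl, rfl, (ofLp_apply f).symm⟩
  · rintro ⟨_, p, rfl, rfl, rfl⟩
    refine ⟨p.memLp.toLp, (ofLp_apply _).trans ((mk_eq_mk (p := pairOfLp _)
      (Measure.AbsolutelyContinuous.refl p.μ) Measure.AbsolutelyContinuous.rfl).2 ?_)⟩
    exact (dens_pairOfLp _).trans (p.memLp.coeFn_toLp.trans p.dens_self.symm)

theorem isClosed_range_ofLp :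
    IsClosed (LinearMap.range (ofLp lam).toLinearMap : Set (UniversalHilbert X)) := by
  rw [LinearMap.coe_range]
  exact (ofLp lam).isometry.isClosedEmbedding.isClosed_range

end ofLp

section CountablyDirected

/-- A set of measures in which any sequence is dominated by a single σ-finite member. -/
def CountablyDirected (G : Set (Measure X)) : Prop :=
  ∀ μ : ℕ → Measure X, (∀ n, μ n ∈ G) → ∃ ν ∈ G, SigmaFinite ν ∧ ∀ n, μ n ≪ ν

variable {G : Set (Measure X)}

theorem CountablyDirected.exists_isClosed_submodule (hG : CountablyDirected G)
    {u : ℕ → UniversalHilbert X} (hu : ∀ n, ∃ μ ∈ G, ∃ f, (u n).IsClass f μ) :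
    ∃ V : Submodule ℝ (UniversalHilbert X), IsClosed (V : Set (UniversalHilbert X)) ∧
      (∀ n, u n ∈ V) ∧ (V : Set (UniversalHilbert X)) ⊆ {v | ∃ μ ∈ G, ∃ f, v.IsClass f μ} := by
  choose μ hμ f hf using hu
  obtain ⟨ν, hν, _, hμν⟩ := hG μ hμ
  exact ⟨LinearMap.range (ofLp ν).toLinearMap, isClosed_range_ofLp,
    fun n => mem_range_ofLp.2 ((hf n).exists_of_absolutelyContinuous (hμν n)),
    fun v hv => ⟨ν, hν, mem_range_ofLp.1 hv⟩⟩

theorem CountablyDirected.exists_isClass_of_mem_closedSpan (hG : CountablyDirected G)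
    (hne : G.Nonempty) {v : UniversalHilbert X} (hv : v ∈ closedSpan G) :
    ∃ μ ∈ G, ∃ f, v.IsClass f μ := by
  refine topologicalClosure_span_subset_of_forall_seq_mem_submodule ?_
    (fun _ hu => hG.exists_isClosed_submodule hu) hv
  obtain ⟨μ, hμ⟩ := hne
  obtain ⟨ν, hν, _, -⟩ := hG (fun _ => μ) fun _ => hμ
  exact ⟨0, ν, hν, mem_range_ofLp.1 (Submodule.zero_mem _)⟩

end CountablyDirected

end UniversalHilbert

namespace TransferOperator

open UniversalHilbert

variable {X : Type*} [MeasurableSpace X] {T : TransferOperator X}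

theorem IsSHat.unique {S₁ S₂ : UniversalHilbert X → UniversalHilbert X} (h₁ : T.IsSHat S₁)
    (h₂ : T.IsSHat S₂) : S₁ = S₂ := by
  funext v
  cases isEmpty_or_nonempty X
  · exact Subsingleton.elim _ _
  · obtain ⟨f, μ, hμ, hv⟩ := exists_isClass_isProbabilityMeasure v
    exact (h₁ v f μ hμ hv).unique (h₂ v f μ hμ hv)

theorem K₁_nonempty [Nonempty X] (T : TransferOperator X) : T.K₁.Nonempty :=
  ⟨_, Measure.dirac (Classical.arbitrary X), inferInstance, rfl⟩

namespace Normalized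

/-- The pair `(f ∘ σ, μR)`, which represents `Ŝ (f √dμ)`. -/
noncomputable def pullback (hT : T.Normalized) (p : Pair X) : Pair X where
  f := p.f ∘ T.σ
  μ := T.act p.μ
  sigmaFinite := hT.sigmaFinite_act p.μ
  measurable := p.measurable.comp T.measurable_σ
  memLp := p.memLp.comp_measurePreserving (hT.measurePreserving p.μ)

theorem dens_pullback (hT : T.Normalized) (p : Pair X) {lam : Measure X} [SigmaFinite lam]
    (h : p.μ ≪ lam) :
    (hT.pullback p).dens (T.act lam) =ᵐ[T.act lam] p.dens lam ∘ T.σ := by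
  filter_upwards [hT.rnDeriv_act h] with x hx
  simp only [Pair.dens, pullback, hx, Function.comp_apply]

theorem inner_mk_pullback (hT : T.Normalized) (p q : Pair X) :
    inner ℝ (UniversalHilbert.mk (hT.pullback p)) (UniversalHilbert.mk (hT.pullback q)) =
      inner ℝ (UniversalHilbert.mk p) (UniversalHilbert.mk q) := by
  let lam : Measure X := p.μ + q.μ
  have p_ac : p.μ ≪ lam := Pair.ac_left p.μ q.μ
  have q_ac : q.μ ≪ lam := Pair.ac_right p.μ q.μ
  have := hT.sigmaFinite_act lam
  calc inner ℝ (UniversalHilbert.mk (hT.pullback p)) (UniversalHilbert.mk (hT.pullback q))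
      = ∫ x, (hT.pullback p).dens (T.act lam) x * (hT.pullback q).dens (T.act lam) x ∂T.act lam :=
        inner_mk _ _ (T.act_absolutelyContinuous p_ac) (T.act_absolutelyContinuous q_ac)
    _ = ∫ x, p.dens lam (T.σ x) * q.dens lam (T.σ x) ∂T.act lam :=
        integral_congr_ae ((hT.dens_pullback p p_ac).mul (hT.dens_pullback q q_ac))
    _ = ∫ x, p.dens lam x * q.dens lam x ∂(T.act lam).map T.σ :=
        (integral_map T.measurable_σ.aemeasurable
          ((p.measurable_dens lam).mul (q.measurable_dens lam)).aestronglyMeasurable).symm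
    _ = ∫ x, p.dens lam x * q.dens lam x ∂lam := by rw [(hT.measurePreserving lam).map_eq]
    _ = inner ℝ (UniversalHilbert.mk p) (UniversalHilbert.mk q) := (inner_mk p q p_ac q_ac).symm

theorem exists_linearIsometry_mk_eq_mk_pullback (hT : T.Normalized) :
    ∃ S : UniversalHilbert X →ₗᵢ[ℝ] UniversalHilbert X,
      ∀ p, S (UniversalHilbert.mk p) = UniversalHilbert.mk (hT.pullback p) :=
  exists_linearIsometry_of_inner_eq
    (by rw [Set.range_eq_univ.2 mk_surj, Submodule.span_univ]) hT.inner_mk_pullback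

/-- The isometry `Ŝ : f √dμ ↦ (f ∘ σ) √d(μR)`. -/
noncomputable def sHat (hT : T.Normalized) : UniversalHilbert X →ₗᵢ[ℝ] UniversalHilbert X :=
  hT.exists_linearIsometry_mk_eq_mk_pullback.choose

theorem sHat_mk (hT : T.Normalized) (p : Pair X) :
    hT.sHat (UniversalHilbert.mk p) = UniversalHilbert.mk (hT.pullback p) :=
  hT.exists_linearIsometry_mk_eq_mk_pullback.choose_spec p

theorem isSHat_sHat (hT : T.Normalized) : T.IsSHat hT.sHat := by
  rintro _ _ _ - ⟨p, rfl, rfl, rfl⟩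
  exact ⟨hT.pullback p, rfl, rfl, (hT.sHat_mk p).symm⟩

theorem countablyDirected_K₁ (hT : T.Normalized) [Nonempty X] : CountablyDirected T.K₁ := by
  intro μ hμ
  choose ν hν hνμ using hμ
  obtain ⟨κ, hκ, sum_ac⟩ := exists_isProbabilityMeasure_absolutelyContinuous (Measure.sum ν)
  refine ⟨T.act κ, ⟨κ, hκ, rfl⟩, hT.sigmaFinite_act κ, fun n => ?_⟩
  rw [← hνμ n]
  exact T.act_absolutelyContinuous ((Measure.absolutelyContinuous_sum_right n
    Measure.AbsolutelyContinuous.rfl).trans sum_ac)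

theorem sHat_mem_closedSpan (hT : T.Normalized) (v : UniversalHilbert X) :
    hT.sHat v ∈ closedSpan T.K₁ := by
  cases isEmpty_or_nonempty X
  · exact Subsingleton.elim 0 (hT.sHat v) ▸ Submodule.zero_mem _
  · obtain ⟨f, μ, hμ, hv⟩ := exists_isClass_isProbabilityMeasure v
    exact Submodule.le_topologicalClosure _
      (Submodule.subset_span ⟨_, ⟨μ, hμ, rfl⟩, _, hT.isSHat_sHat v f μ hμ hv⟩)

theorem inner_mk_pullback_mk (hT : T.Normalized) (p q r : Pair X) {f : BorelFun X}
    (hqμ : q.μ = T.act r.μ) (hqf : q.f = f.1) (hrf : r.f = (T.R f).1) :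
    inner ℝ (UniversalHilbert.mk (hT.pullback p)) (UniversalHilbert.mk q) =
      inner ℝ (UniversalHilbert.mk p) (UniversalHilbert.mk r) := by
  let lam := p.μ + r.μ
  have p_ac : p.μ ≪ lam := Pair.ac_left p.μ r.μ
  have r_ac : r.μ ≪ lam := Pair.ac_right p.μ r.μ
  have pullback_ac : (hT.pullback p).μ ≪ T.act lam := T.act_absolutelyContinuous p_ac
  have q_ac : q.μ ≪ T.act lam := hqμ ▸ T.act_absolutelyContinuous r_ac
  have := hT.sigmaFinite_act lam
  let w : BorelFun X := ⟨fun x => p.dens lam x * √((r.μ.rnDeriv lam x).toReal),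
    (p.measurable_dens lam).mul (Measure.measurable_rnDeriv _ _).ennreal_toReal.sqrt⟩
  have dens_mul_dens : (fun x => (hT.pullback p).dens (T.act lam) x * q.dens (T.act lam) x)
      =ᵐ[T.act lam] fun x => w.1 (T.σ x) * f.1 x := by
    filter_upwards [hT.dens_pullback p p_ac, hT.rnDeriv_act r_ac] with x hp hr
    rw [hp, Pair.dens, hqμ, hqf, hr]
    simp only [w, Function.comp_apply]
    ring
  have integrable : Integrable (fun x => w.1 (T.σ x) * f.1 x) (T.act lam) :=
    (Pair.integrable_dens_mul _ _ (Pair.memLp_dens _ pullback_ac) (q.memLp_dens q_ac)).congr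
      dens_mul_dens
  calc inner ℝ (UniversalHilbert.mk (hT.pullback p)) (UniversalHilbert.mk q)
      = ∫ x, w.1 (T.σ x) * f.1 x ∂T.act lam :=
        (inner_mk _ _ pullback_ac q_ac).trans (integral_congr_ae dens_mul_dens)
    _ = ∫ x, w.1 x * (T.R f).1 x ∂lam := T.integral_comp_mul_act integrable
    _ = ∫ x, p.dens lam x * r.dens lam x ∂lam := by
        refine integral_congr_ae (Eventually.of_forall fun x => ?_)
        simp only [w, Pair.dens, hrf]
        ring
    _ = inner ℝ (UniversalHilbert.mk p) (UniversalHilbert.mk r) := (inner_mk p r p_ac r_ac).symm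

/-- The operator `R̂`, defined as the adjoint of `Ŝ`. -/
noncomputable def rHat (hT : T.Normalized) : UniversalHilbert X →L[ℝ] UniversalHilbert X :=
  ContinuousLinearMap.adjoint hT.sHat.toContinuousLinearMap

theorem inner_sHat_left (hT : T.Normalized) (u v : UniversalHilbert X) :
    inner ℝ (hT.sHat u) v = inner ℝ u (hT.rHat v) :=
  (ContinuousLinearMap.adjoint_inner_right hT.sHat.toContinuousLinearMap u v).symm

theorem isRHat_rHat (hT : T.Normalized) : T.IsRHat hT.rHat where
  of_K₁ := by
    rintro _ f _ ⟨ν, hν, rfl⟩ ⟨q, hqf, hqμ, rfl⟩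
    rw [(hT.measurePreserving ν).map_eq]
    let r : Pair X := ⟨(T.R f).1, ν, inferInstance, (T.R f).2,
      hT.memLp_R (by rw [← hqf, ← hqμ]; exact q.memLp)⟩
    refine ⟨r, rfl, rfl, ext_inner_left ℝ fun u => ?_⟩
    obtain ⟨p, rfl⟩ := mk_surj u
    rw [← hT.inner_sHat_left, hT.sHat_mk, hT.inner_mk_pullback_mk p q r hqμ hqf rfl]
  of_orthogonal v hv := ext_inner_left ℝ fun u => by
    rw [← hT.inner_sHat_left, inner_zero_right]
    exact (Submodule.mem_orthogonal _ v).1 hv _ (hT.sHat_mem_closedSpan u)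

end Normalized

theorem IsRHat.unique (hT : T.Normalized) {R₁ R₂ : UniversalHilbert X →ₗ[ℝ] UniversalHilbert X}
    (h₁ : T.IsRHat R₁) (h₂ : T.IsRHat R₂) : R₁ = R₂ := by
  ext v
  cases isEmpty_or_nonempty X
  · exact Subsingleton.elim _ _
  have : CompleteSpace (closedSpan T.K₁) :=
    (Submodule.isClosed_topologicalClosure _).completeSpace_coe
  obtain ⟨a, ha, b, hb, rfl⟩ := (closedSpan T.K₁).exists_add_mem_mem_orthogonal v
  obtain ⟨μ, hμ, f, hf⟩ := hT.countablyDirected_K₁.exists_isClass_of_mem_closedSpan T.K₁_nonempty ha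
  have eq_on_closedSpan : R₁ a = R₂ a :=
    (h₁.of_K₁ a ⟨f, hf.measurable⟩ μ hμ hf).unique (h₂.of_K₁ a ⟨f, hf.measurable⟩ μ hμ hf)
  rw [map_add, map_add, h₁.of_orthogonal b hb, h₂.of_orthogonal b hb, eq_on_closedSpan]

end TransferOperator

end UHS

theorem mainTheorem8_general {X : Type*} [MeasurableSpace X]
    (T : UHS.TransferOperator X) (hT : T.Normalized) :
    ∃ S R' : UHS.UniversalHilbert X →L[ℝ] UHS.UniversalHilbert X,
      (T.IsSHat S ∧
        ∀ S₁ : UHS.UniversalHilbert X → UHS.UniversalHilbert X, T.IsSHat S₁ → S₁ = S) ∧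
      (T.IsRHat R' ∧
        ∀ R₁ : UHS.UniversalHilbert X →ₗ[ℝ] UHS.UniversalHilbert X, T.IsRHat R₁ →
          ∀ v, R₁ v = R' v) ∧
      R' = ContinuousLinearMap.adjoint S ∧
      ∀ u v : UHS.UniversalHilbert X, inner ℝ (S u) v = inner ℝ u (R' v) := by
  refine ⟨hT.sHat.toContinuousLinearMap, hT.rHat, ⟨hT.isSHat_sHat, fun S₁ hS₁ => ?_⟩,
    ⟨hT.isRHat_rHat, fun R₁ hR₁ v => ?_⟩, rfl, hT.inner_sHat_left⟩
  · exact hS₁.unique hT.isSHat_sHat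
  · exact LinearMap.congr_fun (hR₁.unique hT (R₂ := hT.rHat.toLinearMap) hT.isRHat_rHat) v

theorem mainTheorem8 {X : Type*} [MeasurableSpace X] [StandardBorelSpace X]
    (T : UHS.TransferOperator X) (hT : T.Normalized) :
    ∃ S R' : UHS.UniversalHilbert X →L[ℝ] UHS.UniversalHilbert X,
      (T.IsSHat S ∧
        ∀ S₁ : UHS.UniversalHilbert X → UHS.UniversalHilbert X, T.IsSHat S₁ → S₁ = S) ∧
      (T.IsRHat R' ∧
        ∀ R₁ : UHS.UniversalHilbert X →ₗ[ℝ] UHS.UniversalHilbert X, T.IsRHat R₁ →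
          ∀ v, R₁ v = R' v) ∧
      R' = ContinuousLinearMap.adjoint S ∧
      ∀ u v : UHS.UniversalHilbert X, inner ℝ (S u) v = inner ℝ u (R' v) :=
  mainTheorem8_general T hT
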